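/- A Salem number is a real algebraic integer $\alpha>1$ all of whose conjugates over $\mathbb{Q}$ other than $\alpha$ itself lie in the closed unit disc $\{z\in\mathbb{C}:|z|\le 1\}$, with at least one of them on the unit circle $|z|=1$; its degree is the degree of its minimal polynomial over $\mathbb{Q}$. An algebraic integer is called a unit if it is invertible in the ring of algebraic integers. **Theorem 1.3.** Let $n$ be a natural number with $n\equiv 4 \pmod 8$ and $n\not\equiv 0\pmod 5$. Then for every odd integer $t\ge (n+6)/2$ there exist infinitely many Salem numbers $\alpha$ of degree $2t$ such that $\alpha^n-1$ is a unit. -/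

import Mathlib

/-- A Salem number is a real algebraic integer greater than `1` all of whose other conjugates
(complex roots of its minimal polynomial over `ℚ`) lie in the closed unit disc, at least one of
them lying on the unit circle. -/
def IsSalemNumber (α : ℝ) : Prop :=
  IsIntegral ℤ α ∧ 1 < α ∧
    (∀ z : ℂ, Polynomial.aeval z (minpoly ℚ α) = 0 → z ≠ (α : ℂ) → ‖z‖ ≤ 1) ∧
    ∃ z : ℂ, Polynomial.aeval z (minpoly ℚ α) = 0 ∧ ‖z‖ = 1

/-- A real number is an (algebraic) unit if it is an invertible element of the ring of real
algebraic integers. -/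
def IsAlgebraicUnit (x : ℝ) : Prop :=
  ∃ u : (integralClosure ℤ ℝ)ˣ, ((u : integralClosure ℤ ℝ) : ℝ) = x

/-!
A Salem number `α` of degree `2t` is recovered from its trace `β = α + α⁻¹`, an algebraic integer
of degree `t` with `β > 2` and all other conjugates in `(-2, 2)`. For `n = 2(k + 1)` let `E` be the
monic integer polynomial with the `k + 2` simple roots `2 cos (jπ / (k + 1))`. Since
`α ^ n - 1 = α ^ (k + 1) (α - α⁻¹)⁻¹ E(β)`, it is enough that `E(β)` divides `1`, that is, that `β`
is a root of `E G - 1` for some integer polynomial `G`.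

Take `G = X ^ (d + 1) - a H`, where `H` has degree `d` and simple, nonintegral roots in `(0, 1)`.
For large `a`, `E G - 1` is negative at `±2` and has the sign of `-E H` at given points between
consecutive roots of `E H`, so all its roots but one lie in `(-2, 2)`, and the remaining one
exceeds `2`. If `E G - 1` is reducible, a factor not vanishing at `β` has all its roots in
`(-2, 2)`. There are finitely many algebraic integers of bounded degree with all conjugates there,
and each is a root for at most one `a`, because `H` does not vanish at algebraic integers.
-/

open Polynomial IntermediateField Filter

theorem isIntegral_of_isIntegral_add_inv {R K : Type*} [CommRing R] [Field K] [Algebra R K]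
    {z : K} (h : IsIntegral R (z + z⁻¹)) : IsIntegral R z := by
  rcases eq_or_ne z 0 with rfl | hz
  · exact isIntegral_zero
  let b : integralClosure R K := ⟨z + z⁻¹, h⟩
  refine isIntegral_trans (A := integralClosure R K) z
    ⟨X ^ 2 - C b * X + 1, by monicity!, ?_⟩
  simp only [eval₂_add, eval₂_sub, eval₂_mul, eval₂_pow, eval₂_X, eval₂_C, eval₂_one]
  change z ^ 2 - (z + z⁻¹) * z + 1 = 0
  field_simp
  ring

theorem natDegree_minpoly_eq_two_mul {F K : Type*} [Field F] [Field K] [Algebra F K] {α : K}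
    (hα : IsIntegral F α) (h : α ∉ F⟮α + α⁻¹⟯) :
    (minpoly F α).natDegree = 2 * (minpoly F (α + α⁻¹)).natDegree := by
  have hα0 : α ≠ 0 := by
    rintro rfl
    exact h (zero_mem _)
  have hmem : α + α⁻¹ ∈ F⟮α⟯ :=
    add_mem (mem_adjoin_simple_self F α) (inv_mem (mem_adjoin_simple_self F α))
  generalize hβ : α + α⁻¹ = β at h hmem ⊢
  have hquad : (minpoly F⟮β⟯ α).natDegree = 2 := by
    let q : F⟮β⟯[X] := X ^ 2 - C (AdjoinSimple.gen F β) * X + 1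
    have hq : q.natDegree = 2 := by unfold q; compute_degree!
    have hroot : aeval α q = 0 := by
      simp only [q, map_add, map_sub, map_mul, map_pow, aeval_X, aeval_C, map_one,
        AdjoinSimple.algebraMap_gen, ← hβ]
      field_simp
      ring
    refine le_antisymm ?_ ((minpoly.two_le_natDegree_iff hα.tower_top).2 ?_)
    · exact hq ▸ natDegree_le_of_dvd (minpoly.dvd _ _ hroot)
        (ne_zero_of_natDegree_gt (n := 1) (by omega))
    · rintro ⟨y, hy⟩
      exact h (hy ▸ y.2)
  have hβint : IsIntegral F β := hβ ▸ hα.add hα.inv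
  have htop : F⟮β⟯⟮α⟯.restrictScalars F = F⟮α⟯ := by
    rw [adjoin_simple_adjoin_simple]
    exact le_antisymm
      (adjoin_le_iff.2 (Set.pair_subset hmem (mem_adjoin_simple_self F α)))
      (adjoin.mono _ _ _ (Set.singleton_subset_iff.2 (Set.mem_insert_of_mem _ rfl)))
  calc (minpoly F α).natDegree = Module.finrank F (F⟮β⟯⟮α⟯.restrictScalars F) := by
        rw [htop, adjoin.finrank hα]
    _ = Module.finrank F F⟮β⟯ * Module.finrank F⟮β⟯ F⟮β⟯⟮α⟯ :=
        (Module.finrank_mul_finrank F F⟮β⟯ F⟮β⟯⟮α⟯).symm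
    _ = 2 * (minpoly F β).natDegree := by
        rw [adjoin.finrank hβint, adjoin.finrank hα.tower_top, hquad, mul_comm]

theorem aeval_add_inv_minpoly_add_inv {F K L : Type*} [Field F] [Field K] [Field L] [Algebra F K]
    [Algebra F L] {α : K} (hα : IsIntegral F α) {z : L} (hz : aeval z (minpoly F α) = 0) :
    aeval (z + z⁻¹) (minpoly F (α + α⁻¹)) = 0 := by
  have hz' : z ∈ (minpoly F α).aroots L := mem_aroots.2 ⟨minpoly.ne_zero hα, hz⟩
  let σ : F⟮α⟯ →ₐ[F] L := (algHomAdjoinIntegralEquiv F hα).symm ⟨z, hz'⟩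
  have hσ : σ (AdjoinSimple.gen F α) = z := algHomAdjoinIntegralEquiv_symm_apply_gen F hα ⟨z, hz'⟩
  have hmin : minpoly F (α + α⁻¹) =
      minpoly F (AdjoinSimple.gen F α + (AdjoinSimple.gen F α)⁻¹) := by
    rw [← minpoly.algebraMap_eq (algebraMap F⟮α⟯ K).injective, map_add, map_inv₀,
      AdjoinSimple.algebraMap_gen]
  rw [hmin, ← hσ, ← map_inv₀, ← map_add, aeval_algHom_apply, minpoly.aeval, map_zero]

theorem norm_eq_one_of_add_inv_eq {z : ℂ} (hz : z ≠ 0) {x : ℝ} (hx : x ∈ Set.Ioo (-2 : ℝ) 2)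
    (h : z + z⁻¹ = x) : ‖z‖ = 1 := by
  have hq : z ^ 2 - x * z + 1 = 0 := by
    field_simp at h
    linear_combination h
  have hre : z.re ^ 2 - z.im ^ 2 - x * z.re + 1 = 0 := by
    simpa [pow_two] using congrArg Complex.re hq
  have him : z.im * (2 * z.re - x) = 0 := by
    have him_eq : z.re * z.im + z.im * z.re - x * z.im = 0 := by
      simpa [pow_two] using congrArg Complex.im hq
    linear_combination him_eq
  rcases mul_eq_zero.1 him with hreal | htwo
  · rw [hreal] at hre
    nlinarith [sq_nonneg (z.re - x / 2), hx.1, hx.2]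
  · rw [← sq_eq_sq₀ (norm_nonneg z) zero_le_one, ← Complex.normSq_eq_norm_sq, Complex.normSq_apply]
    linear_combination z.re * htwo - hre

theorem eq_or_eq_inv_of_add_inv_eq {K : Type*} [Field K] {z w : K} (hz : z ≠ 0) (hw : w ≠ 0)
    (h : z + z⁻¹ = w + w⁻¹) : z = w ∨ z = w⁻¹ := by
  have : (z - w) * (z * w - 1) = 0 := by
    field_simp at h
    linear_combination h
  rcases mul_eq_zero.1 this with h | h
  · exact .inl (sub_eq_zero.1 h)
  · exact .inr (eq_inv_of_mul_eq_one_left (sub_eq_zero.1 h))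

theorem exists_one_lt_add_inv_eq {β : ℝ} (h : 2 < β) : ∃ α : ℝ, 1 < α ∧ α + α⁻¹ = β := by
  have hsqrt := Real.sq_sqrt (show (0 : ℝ) ≤ β ^ 2 - 4 by nlinarith)
  have hpos := Real.sqrt_nonneg (β ^ 2 - 4)
  have hα : 1 < (β + √(β ^ 2 - 4)) / 2 := by linarith
  refine ⟨_, hα, ?_⟩
  have := (zero_lt_one.trans hα).ne'
  field_simp
  linear_combination hsqrt

/-- A Salem trace: a number of the form `α + α⁻¹` with `α` a Salem number, characterised by its
conjugates. Being the images of the conjugates of `α` on the unit circle under `z ↦ z + z⁻¹`, the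
complex conjugates of `β` other than `β` itself are required to be real. -/
structure IsSalemTrace (β : ℝ) : Prop where
  isIntegral : IsIntegral ℤ β
  two_lt : 2 < β
  mem_Ioo_of_conj : ∀ z : ℂ, aeval z (minpoly ℚ β) = 0 → z ≠ β →
    ∃ x : ℝ, x ∈ Set.Ioo (-2) 2 ∧ (x : ℂ) = z
  exists_conj : ∃ z : ℂ, aeval z (minpoly ℚ β) = 0 ∧ z ≠ β

namespace IsSalemTrace

variable {α : ℝ}

theorem isIntegral_of_add_inv (h : IsSalemTrace (α + α⁻¹)) : IsIntegral ℚ α :=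
  (isIntegral_of_isIntegral_add_inv h.isIntegral).tower_top

theorem notMem_adjoin_add_inv (h : IsSalemTrace (α + α⁻¹)) (hα : α ≠ 0) :
    α ∉ ℚ⟮α + α⁻¹⟯ := by
  intro hmem
  obtain ⟨z, hz, hne⟩ := h.exists_conj
  obtain ⟨x, hx, rfl⟩ := h.mem_Ioo_of_conj z hz hne
  have hroot : x ∈ (minpoly ℚ (α + α⁻¹)).aroots ℝ := by
    refine mem_aroots.2 ⟨minpoly.ne_zero h.isIntegral.tower_top, ?_⟩
    exact (aeval_algebraMap_eq_zero_iff ℂ x _).1 hz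
  let σ : ℚ⟮α + α⁻¹⟯ →ₐ[ℚ] ℝ :=
    (algHomAdjoinIntegralEquiv ℚ h.isIntegral.tower_top).symm ⟨x, hroot⟩
  have hσ : σ (AdjoinSimple.gen ℚ (α + α⁻¹)) = x :=
    algHomAdjoinIntegralEquiv_symm_apply_gen ℚ h.isIntegral.tower_top ⟨x, hroot⟩
  let a : ℚ⟮α + α⁻¹⟯ := ⟨α, hmem⟩
  have ha : a ≠ 0 := fun h0 ↦ hα (congrArg Subtype.val h0)
  have hsum : σ a + (σ a)⁻¹ = x := by
    rw [← hσ, ← map_inv₀, ← map_add]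
    rfl
  have hne : σ a ≠ 0 := (map_ne_zero σ).2 ha
  field_simp at hsum
  nlinarith [sq_nonneg (σ a - x / 2), hx.1, hx.2]

theorem natDegree_minpoly (h : IsSalemTrace (α + α⁻¹)) (hα : α ≠ 0) :
    (minpoly ℚ α).natDegree = 2 * (minpoly ℚ (α + α⁻¹)).natDegree :=
  natDegree_minpoly_eq_two_mul h.isIntegral_of_add_inv (h.notMem_adjoin_add_inv hα)

theorem two_le_natDegree {β : ℝ} (h : IsSalemTrace β) : 2 ≤ (minpoly ℚ β).natDegree := by
  refine (minpoly.two_le_natDegree_iff h.isIntegral.tower_top).2 ?_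
  rintro ⟨q, rfl⟩
  obtain ⟨z, hz, hne⟩ := h.exists_conj
  apply hne
  rw [minpoly.eq_X_sub_C, map_sub, aeval_X, aeval_C, sub_eq_zero] at hz
  simpa using hz

theorem norm_eq_one (h : IsSalemTrace (α + α⁻¹)) (hα : α ≠ 0) {z : ℂ}
    (hz : aeval z (minpoly ℚ α) = 0) (hne : z ≠ α) (hne' : z ≠ (α : ℂ)⁻¹) : ‖z‖ = 1 := by
  have hz0 : z ≠ 0 := by
    rintro rfl
    rw [← coeff_zero_eq_aeval_zero', map_eq_zero] at hz
    exact minpoly.coeff_zero_ne_zero h.isIntegral_of_add_inv hα hz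
  obtain ⟨x, hx, hxz⟩ := h.mem_Ioo_of_conj _
    (aeval_add_inv_minpoly_add_inv h.isIntegral_of_add_inv hz) fun heq ↦ by
      push_cast at heq
      exact (eq_or_eq_inv_of_add_inv_eq hz0 (by exact_mod_cast hα) heq).elim hne hne'
  exact norm_eq_one_of_add_inv_eq hz0 hx hxz.symm

theorem isSalemNumber (h : IsSalemTrace (α + α⁻¹)) (hα : 1 < α) : IsSalemNumber α := by
  have hα0 : α ≠ 0 := by positivity
  refine ⟨isIntegral_of_isIntegral_add_inv h.isIntegral, hα, fun z hz hne ↦ ?_, ?_⟩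
  · by_cases hinv : z = (α : ℂ)⁻¹
    · rw [hinv, norm_inv, Complex.norm_of_nonneg (by positivity)]
      exact inv_le_one_of_one_le₀ hα.le
    · exact (h.norm_eq_one hα0 hz hne hinv).le
  · by_contra! hno
    have hsub : (minpoly ℚ α).rootSet ℂ ⊆ {(α : ℂ), (α : ℂ)⁻¹} := fun z hz ↦ by
      by_contra hz'
      simp only [Set.mem_insert_iff, Set.mem_singleton_iff, not_or] at hz'
      have hroot := aeval_eq_zero_of_mem_rootSet hz
      exact hno z hroot (h.norm_eq_one hα0 hroot hz'.1 hz'.2)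
    have hcard : ((minpoly ℚ α).rootSet ℂ).ncard = (minpoly ℚ α).natDegree := by
      rw [Set.ncard_eq_toFinset_card', Set.toFinset_card]
      exact card_rootSet_eq_natDegree (minpoly.irreducible h.isIntegral_of_add_inv).separable
        (IsAlgClosed.splits _)
    have := (Set.ncard_le_ncard hsub).trans (Set.ncard_insert_le _ _)
    rw [hcard, Set.ncard_singleton] at this
    have := h.natDegree_minpoly hα0
    have := h.two_le_natDegree
    omega

end IsSalemTrace

/-- The polynomial of degree `k + 2` whose roots are the traces `ζ + ζ⁻¹` of the `ζ` with
`ζ ^ (2 * (k + 1)) = 1`. Here `dickson 1 1 m` is the polynomial expressing `z ^ m + z⁻¹ ^ m` in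
terms of `z + z⁻¹`. -/
noncomputable def unityTracePoly (k : ℕ) : ℤ[X] :=
  dickson 1 1 (k + 2) - dickson 1 1 k

theorem unityTracePoly_add_two (k : ℕ) :
    unityTracePoly (k + 2) = X * unityTracePoly (k + 1) - unityTracePoly k := by
  simp only [unityTracePoly, dickson_add_two, map_one]
  ring

theorem monic_unityTracePoly_and_natDegree (k : ℕ) :
    (unityTracePoly k).Monic ∧ (unityTracePoly k).natDegree = k + 2 := by
  induction k using Nat.twoStepInduction with
  | zero =>
    have h : unityTracePoly 0 = X ^ 2 - C 4 := by
      simp only [unityTracePoly, zero_add, dickson_two, dickson_zero,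
        Nat.cast_one, map_one, map_ofNat]
      ring
    rw [h]
    exact ⟨monic_X_pow_sub_C 4 two_ne_zero, natDegree_X_pow_sub_C⟩
  | one =>
    have h : unityTracePoly 1 = X ^ 3 - C 4 * X := by
      simp only [unityTracePoly, dickson_add_two, zero_add, dickson_one, dickson_zero,
        Nat.cast_one, map_one, map_ofNat]
      ring
    rw [h]
    exact ⟨by monicity!, by compute_degree!⟩
  | more k ih₀ ih₁ =>
    have hX := monic_X.natDegree_mul ih₁.1
    rw [natDegree_X, ih₁.2] at hX
    have hlt : (unityTracePoly k).natDegree < (X * unityTracePoly (k + 1)).natDegree := by omega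
    rw [unityTracePoly_add_two]
    exact ⟨(monic_X.mul ih₁.1).sub_of_left (degree_lt_degree hlt),
      by rw [natDegree_sub_eq_left_of_natDegree_lt hlt]; omega⟩

theorem aeval_unityTracePoly {K : Type*} [CommRing K] (k : ℕ) (x : K) :
    aeval x (unityTracePoly k) = (dickson 1 (1 : K) (k + 2)).eval x - (dickson 1 1 k).eval x := by
  simp [unityTracePoly, aeval_def, eval₂_eq_eval_map, map_dickson]

theorem aeval_unityTracePoly_add_inv {K : Type*} [Field K] (k : ℕ) {z : K} (hz : z ≠ 0) :
    aeval (z + z⁻¹) (unityTracePoly k) = (z - z⁻¹) * (z ^ (k + 1) - z⁻¹ ^ (k + 1)) := by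
  have hinv := mul_inv_cancel₀ hz
  rw [aeval_unityTracePoly, dickson_one_one_eval_add_inv _ _ hinv,
    dickson_one_one_eval_add_inv _ _ hinv]
  linear_combination (z ^ k + z⁻¹ ^ k) * hinv

theorem aeval_unityTracePoly_two_mul_cos (k : ℕ) (θ : ℝ) :
    aeval (2 * Real.cos θ) (unityTracePoly k) =
      -4 * Real.sin θ * Real.sin ((k + 1) * θ) := by
  rw [aeval_unityTracePoly, dickson_one_one_eq_chebyshev_C, dickson_one_one_eq_chebyshev_C,
    Chebyshev.C_two_mul_real_cos, Chebyshev.C_two_mul_real_cos, ← mul_sub, Real.cos_sub_cos]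
  push_cast
  ring_nf

theorem isAlgebraicUnit_of_mul_eq_one {x y : ℝ} (hx : IsIntegral ℤ x) (hy : IsIntegral ℤ y)
    (h : x * y = 1) : IsAlgebraicUnit x :=
  ⟨⟨⟨x, hx⟩, ⟨y, hy⟩, Subtype.ext h, Subtype.ext ((mul_comm y x).trans h)⟩, rfl⟩

theorem isAlgebraicUnit_pow_sub_one {α : ℝ} (hα : α ≠ 0) (hsum_int : IsIntegral ℤ (α + α⁻¹))
    (k : ℕ) {G : ℤ[X]} (h : aeval (α + α⁻¹) (unityTracePoly k * G) = 1) :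
    IsAlgebraicUnit (α ^ (2 * (k + 1)) - 1) := by
  have hα_int : IsIntegral ℤ α := isIntegral_of_isIntegral_add_inv hsum_int
  have hinv_int : IsIntegral ℤ α⁻¹ :=
    isIntegral_of_isIntegral_add_inv (by rwa [inv_inv, add_comm])
  have hG : IsIntegral ℤ (aeval (α + α⁻¹) G) :=
    adjoin_le_integralClosure hsum_int (aeval_mem_adjoin_singleton ℤ _)
  refine isAlgebraicUnit_of_mul_eq_one ((hα_int.pow _).sub isIntegral_one)
    (((hinv_int.pow (k + 1)).mul (hα_int.sub hinv_int)).mul hG) ?_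
  rw [map_mul, aeval_unityTracePoly_add_inv k hα] at h
  have hpow : α ^ (k + 1) * α⁻¹ ^ (k + 1) = 1 := by rw [← mul_pow, mul_inv_cancel₀ hα, one_pow]
  have hfactor : α ^ (2 * (k + 1)) - 1 = α ^ (k + 1) * (α ^ (k + 1) - α⁻¹ ^ (k + 1)) := by
    linear_combination hpow
  rw [hfactor]
  linear_combination h * (α ^ (k + 1) * α⁻¹ ^ (k + 1)) + hpow

theorem prod_X_sub_C_dvd {R : Type*} [CommRing R] [IsDomain R] {f : R[X]} {s : Finset R}
    (hf : f ≠ 0) (hs : ∀ r ∈ s, f.IsRoot r) : ∏ r ∈ s, (X - C r) ∣ f :=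
  (Multiset.prod_X_sub_C_dvd_iff_le_roots hf s.val).2 <|
    (Multiset.le_iff_subset s.nodup).2 fun r hr ↦ (mem_roots hf).2 (hs r hr)

theorem eq_prod_X_sub_C {R : Type*} [CommRing R] [IsDomain R] {f : R[X]} {s : Finset R}
    (hf : f.Monic) (hs : ∀ r ∈ s, f.IsRoot r) (hdeg : f.natDegree ≤ s.card) :
    f = ∏ r ∈ s, (X - C r) := by
  refine eq_of_monic_of_dvd_of_natDegree_le (monic_prod_X_sub_C id s) hf
    (prod_X_sub_C_dvd hf.ne_zero hs) ?_
  rwa [natDegree_finsetProd_X_sub_C_eq_card]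

theorem exists_eq_X_sub_C_mul_prod {R : Type*} [CommRing R] [IsDomain R] {f : R[X]} {s : Finset R}
    (hf : f.Monic) (hs : ∀ r ∈ s, f.IsRoot r) (hdeg : f.natDegree = s.card + 1) :
    ∃ b, f = (X - C b) * ∏ r ∈ s, (X - C r) := by
  obtain ⟨g, rfl⟩ := prod_X_sub_C_dvd hf.ne_zero hs
  have hprod := monic_prod_X_sub_C id s
  have hg : g.Monic := hprod.of_mul_monic_left hf
  have hprod_deg := natDegree_finsetProd_X_sub_C_eq_card s fun r : R ↦ r
  simp only [id] at hprod
  rw [hprod.natDegree_mul hg, hprod_deg] at hdeg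
  have := hg.eq_X_add_C (by omega)
  refine ⟨-g.coeff 0, ?_⟩
  rw [map_neg, sub_neg_eq_add, ← this, mul_comm]

theorem monic_of_map_eq_prod {K : Type*} [CommRing K] [CharZero K] {f : ℤ[X]} {s : Finset K}
    (hf : f.map (algebraMap ℤ K) = ∏ r ∈ s, (X - C r)) : f.Monic :=
  monic_of_injective (algebraMap ℤ K).injective_int (hf ▸ monic_prod_X_sub_C id s)

theorem natDegree_of_map_eq_prod {K : Type*} [CommRing K] [CharZero K] {f : ℤ[X]} {s : Finset K}
    (hf : f.map (algebraMap ℤ K) = ∏ r ∈ s, (X - C r)) : f.natDegree = s.card := by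
  rw [← (monic_of_map_eq_prod hf).natDegree_map (algebraMap ℤ K), hf,
    natDegree_finsetProd_X_sub_C_eq_card]

theorem aeval_of_map_eq_prod {K : Type*} [CommRing K] {f : ℤ[X]} {s : Finset K}
    (hf : f.map (algebraMap ℤ K) = ∏ r ∈ s, (X - C r)) (x : K) :
    aeval x f = ∏ r ∈ s, (x - r) := by
  rw [← eval_map_algebraMap, hf, eval_prod]
  simp only [eval_sub, eval_X, eval_C]

theorem exists_map_unityTracePoly_eq_prod (k : ℕ) :
    ∃ s : Finset ℝ, s.card = k + 2 ∧ IsLeast ↑s (-2 : ℝ) ∧ IsGreatest ↑s (2 : ℝ) ∧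
      (unityTracePoly k).map (algebraMap ℤ ℝ) = ∏ r ∈ s, (X - C r) := by
  obtain ⟨hmonic, hdeg⟩ := monic_unityTracePoly_and_natDegree k
  have hk : (k + 1 : ℝ) ≠ 0 := by positivity
  let θ (j : ℕ) : ℝ := j * Real.pi / (k + 1)
  have hθ_mem : ∀ j ∈ Finset.range (k + 2), θ j ∈ Set.Icc 0 Real.pi := fun j hj ↦ by
    have hj' : (j : ℝ) ≤ k + 1 := by exact_mod_cast Finset.mem_range_succ_iff.1 hj
    refine ⟨by positivity, (div_le_iff₀ (by positivity)).2 ?_⟩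
    rw [mul_comm Real.pi]
    exact mul_le_mul_of_nonneg_right hj' Real.pi_pos.le
  have hθ_last : θ (k + 1) = Real.pi := by
    simp only [θ, Nat.cast_add_one, mul_div_cancel_left₀ _ hk]
  have hinj : Set.InjOn (fun j ↦ 2 * Real.cos (θ j)) (Finset.range (k + 2)) := fun i hi j hj h ↦ by
    have := Real.injOn_cos (hθ_mem i hi) (hθ_mem j hj) (mul_left_cancel₀ two_ne_zero h)
    simp only [θ, div_left_inj' hk, mul_left_inj' Real.pi_ne_zero] at this
    exact_mod_cast this
  refine ⟨(Finset.range (k + 2)).image fun j ↦ 2 * Real.cos (θ j), ?_, ⟨?_, ?_⟩, ⟨?_, ?_⟩,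
    eq_prod_X_sub_C (hmonic.map _) ?_ ?_⟩
  · rw [Finset.card_image_of_injOn hinj, Finset.card_range]
  · exact Finset.mem_image.2 ⟨k + 1, by simp, by simp [hθ_last]⟩
  · simp only [mem_lowerBounds, Finset.mem_coe, Finset.forall_mem_image]
    exact fun j _ ↦ by linarith [Real.neg_one_le_cos (θ j)]
  · exact Finset.mem_image.2 ⟨0, by simp, by simp [θ]⟩
  · simp only [mem_upperBounds, Finset.mem_coe, Finset.forall_mem_image]
    exact fun j _ ↦ by linarith [Real.cos_le_one (θ j)]
  · refine Finset.forall_mem_image.2 fun j _ ↦ ?_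
    rw [IsRoot, eval_map_algebraMap, aeval_unityTracePoly_two_mul_cos,
      mul_div_cancel₀ _ hk, Real.sin_nat_mul_pi, mul_zero]
  · rw [hmonic.natDegree_map, hdeg, Finset.card_image_of_injOn hinj, Finset.card_range]

theorem neg_one_pow_card_mul_prod_sub_pos {K : Type*} [Field K] [LinearOrder K]
    [IsStrictOrderedRing K] {v : Finset K} {x : K} (hx : x ∉ v) :
    0 < (-1) ^ (v.filter (x < ·)).card * ∏ r ∈ v, (x - r) := by
  rw [← Finset.prod_filter_mul_prod_filter_not v (x < ·), ← mul_assoc, ← Finset.prod_const,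
    ← Finset.prod_mul_distrib]
  refine mul_pos (Finset.prod_pos fun r hr ↦ ?_) (Finset.prod_pos fun r hr ↦ ?_)
  · have := (Finset.mem_filter.1 hr).2
    linarith
  · obtain ⟨hrv, hxr⟩ := Finset.mem_filter.1 hr
    exact sub_pos.2 ((not_lt.1 hxr).lt_of_ne (ne_of_mem_of_not_mem hrv hx))

section Gap

variable {K : Type*} [LinearOrder K] {v : Finset K} {n i : ℕ} {x : K}

theorem lt_orderEmbOfFin_iff_of_mem_gap (hn : v.card = n + 1)
    (h₀ : v.orderEmbOfFin hn (Fin.clamp i n) < x)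
    (h₁ : x < v.orderEmbOfFin hn (Fin.clamp (i + 1) n)) {j : Fin (n + 1)} :
    x < v.orderEmbOfFin hn j ↔ Fin.clamp (i + 1) n ≤ j := by
  refine ⟨fun h ↦ ?_, fun h ↦ h₁.trans_le ((v.orderEmbOfFin hn).monotone h)⟩
  have hlt := Fin.lt_def.1 ((v.orderEmbOfFin hn).lt_iff_lt.1 (h₀.trans h))
  rw [Fin.le_def]
  simp only [Fin.coe_clamp] at hlt ⊢
  omega

theorem card_filter_lt_of_mem_gap (hn : v.card = n + 1) (hi : i < n)
    (h₀ : v.orderEmbOfFin hn (Fin.clamp i n) < x)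
    (h₁ : x < v.orderEmbOfFin hn (Fin.clamp (i + 1) n)) :
    (v.filter (x < ·)).card = n - i := by
  conv_lhs => rw [← Finset.map_orderEmbOfFin_univ v hn, Finset.filter_map, Finset.card_map]
  have hIci : Finset.univ.filter ((x < ·) ∘ (v.orderEmbOfFin hn).toEmbedding) =
      Finset.Ici (Fin.clamp (i + 1) n) := by
    ext j
    simpa using lt_orderEmbOfFin_iff_of_mem_gap hn h₀ h₁
  rw [hIci, Fin.card_Ici, Fin.coe_clamp]
  omega

theorem notMem_of_mem_gap (hn : v.card = n + 1)
    (h₀ : v.orderEmbOfFin hn (Fin.clamp i n) < x)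
    (h₁ : x < v.orderEmbOfFin hn (Fin.clamp (i + 1) n)) : x ∉ v := by
  intro hx
  obtain ⟨j, rfl⟩ : x ∈ Set.range (v.orderEmbOfFin hn) := by simpa using hx
  have hj := (lt_orderEmbOfFin_iff_of_mem_gap hn h₀ h₁).not.1 (lt_irrefl _)
  exact h₀.not_ge ((v.orderEmbOfFin hn).monotone (Fin.le_def.2 (by
    simp only [Fin.le_def, Fin.coe_clamp] at hj ⊢
    omega)))

end Gap

theorem exists_gap_points {K : Type*} [Field K] [LinearOrder K] [IsStrictOrderedRing K]
    {v : Finset K} {a b : K} (hv : 1 < v.card) (ha : IsLeast ↑v a) (hb : IsGreatest ↑v b) :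
    ∃ x : ℕ → K, x 0 = a ∧ x v.card = b ∧ (∀ i < v.card, x i < x (i + 1)) ∧
      ∀ i, 0 < i → i < v.card → 0 < (-1) ^ (v.card + i) * ∏ r ∈ v, (x i - r) := by
  obtain ⟨n, hn⟩ : ∃ n, v.card = n + 1 := ⟨v.card - 1, by omega⟩
  let y : ℕ → K := fun i ↦ v.orderEmbOfFin hn (Fin.clamp i n)
  have hy_lt {i j : ℕ} (hij : i < j) (hi : i < n) : y i < y j :=
    (v.orderEmbOfFin hn).strictMono (Fin.lt_def.2 (by simp only [Fin.coe_clamp]; omega))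
  have hy_le {i j : ℕ} (hij : i ≤ j) : y i ≤ y j :=
    (v.orderEmbOfFin hn).monotone (Fin.le_def.2 (by simp only [Fin.coe_clamp]; omega))
  have hy_zero : y 0 = a :=
    (Finset.orderEmbOfFin_zero hn n.succ_pos).trans ((v.isLeast_min' _).unique ha)
  have hy_last {i : ℕ} (hi : n ≤ i) : y i = b := by
    have : Fin.clamp i n = Fin.last n := Fin.ext (min_eq_right hi)
    exact (congrArg _ this).trans
      ((Finset.orderEmbOfFin_last hn n.succ_pos).trans ((v.isGreatest_max' _).unique hb))
  refine ⟨fun i ↦ (y (i - 1) + y i) / 2, ?_, ?_, fun i hi ↦ ?_, fun i hi₀ hi ↦ ?_⟩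
  · simp only [hy_zero, zero_tsub, add_self_div_two]
  · simp only [hy_last (show n ≤ v.card - 1 by omega), hy_last (show n ≤ v.card by omega),
      add_self_div_two]
  · simp only [Nat.add_sub_cancel]
    linarith [hy_le (show i - 1 ≤ i by omega), hy_le (show i ≤ i + 1 by omega),
      hy_lt (show i - 1 < i + 1 by omega) (by omega)]
  · obtain ⟨j, rfl⟩ : ∃ j, i = j + 1 := ⟨i - 1, by omega⟩
    have hlt := hy_lt j.lt_succ_self (by omega)
    have h₀ : y j < (y j + y (j + 1)) / 2 := left_lt_add_div_two.2 hlt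
    have h₁ : (y j + y (j + 1)) / 2 < y (j + 1) := add_div_two_lt_right.2 hlt
    have hparity : v.card + (j + 1) = (n - j) + 2 * (j + 1) := by omega
    simp only [Nat.add_sub_cancel]
    rw [hparity, pow_add, pow_mul, neg_one_sq, one_pow, mul_one,
      ← card_filter_lt_of_mem_gap hn (by omega) h₀ h₁]
    exact neg_one_pow_card_mul_prod_sub_pos (notMem_of_mem_gap hn h₀ h₁)

theorem exists_zero_mem_Ioo_of_mul_neg {f : ℝ → ℝ} (hf : Continuous f) {a b : ℝ} (hab : a < b)
    (h : f a * f b < 0) : ∃ r ∈ Set.Ioo a b, f r = 0 := by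
  rcases mul_neg_iff.1 h with h | h
  · exact intermediate_value_Ioo' hab.le hf.continuousOn ⟨h.2, h.1⟩
  · exact intermediate_value_Ioo hab.le hf.continuousOn ⟨h.1, h.2⟩

theorem exists_finset_zeros_of_alternating {f : ℝ → ℝ} (hf : Continuous f) {x : ℕ → ℝ} {m : ℕ}
    (hx : ∀ i < m, x i < x (i + 1)) (hsign : ∀ i ≤ m, 0 < (-1) ^ i * f (x i)) :
    ∃ s : Finset ℝ, s.card = m ∧ ↑s ⊆ Set.Ioo (x 0) (x m) ∧ ∀ r ∈ s, f r = 0 := by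
  induction m with
  | zero => exact ⟨∅, by simp⟩
  | succ m ih =>
    obtain ⟨s, hcard, hsub, hzero⟩ := ih (fun i hi ↦ hx i (by omega)) fun i hi ↦ hsign i (by omega)
    have hneg : f (x m) * f (x (m + 1)) < 0 := by
      have := mul_pos (hsign m (by omega)) (hsign (m + 1) le_rfl)
      have hsq : ((-1 : ℝ) ^ m) ^ 2 = 1 := by rw [← pow_mul, mul_comm, pow_mul, neg_one_sq, one_pow]
      rw [pow_succ] at this
      linear_combination this - f (x m) * f (x (m + 1)) * hsq
    obtain ⟨r, hr, hr0⟩ := exists_zero_mem_Ioo_of_mul_neg hf (hx m m.lt_succ_self) hneg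
    have hx0 : x 0 ≤ x m := by
      rcases s.eq_empty_or_nonempty with rfl | ⟨q, hq⟩
      · rw [← hcard, Finset.card_empty]
      · exact ((hsub hq).1.trans (hsub hq).2).le
    have hrs : r ∉ s := fun h ↦ (hsub h).2.not_gt hr.1
    refine ⟨insert r s, by rw [Finset.card_insert_of_notMem hrs, hcard], ?_, ?_⟩
    · rw [Finset.coe_insert]
      exact Set.insert_subset ⟨hx0.trans_lt hr.1, hr.2⟩
        (hsub.trans (Set.Ioo_subset_Ioo_right (hx m m.lt_succ_self).le))
    · exact (Finset.forall_mem_insert _ _ _).2 ⟨hr0, hzero⟩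

/-- An integer polynomial with the roots `1 / (j + 2)` for `j < d`; none of them is integral. -/
noncomputable def unitFractionPoly (d : ℕ) : ℤ[X] :=
  ∏ j ∈ Finset.range d, (C (j + 2 : ℤ) * X - 1)

theorem natDegree_unitFractionPoly_le (d : ℕ) : (unitFractionPoly d).natDegree ≤ d := by
  refine (natDegree_prod_le _ _).trans <| (Finset.sum_le_card_nsmul _ _ 1 fun j _ ↦ ?_).trans ?_
  · compute_degree
  · simp

theorem aeval_unitFractionPoly {K : Type*} [CommRing K] (d : ℕ) (x : K) :
    aeval x (unitFractionPoly d) = ∏ j ∈ Finset.range d, ((j + 2) * x - 1) := by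
  simp [unitFractionPoly, map_prod, map_ofNat]

theorem aeval_unitFractionPoly_ne_zero {K : Type*} [Field K] [CharZero K] (d : ℕ) {x : K}
    (hx : IsIntegral ℤ x) : aeval x (unitFractionPoly d) ≠ 0 := by
  rw [aeval_unitFractionPoly, Finset.prod_ne_zero_iff]
  intro j _ h0
  have hj : ((j + 2 : ℕ) : K) ≠ 0 := Nat.cast_ne_zero.2 (by omega)
  have hq : x = algebraMap ℚ K (1 / (j + 2 : ℕ)) := by
    rw [map_div₀, map_one, map_natCast, eq_div_iff hj]
    push_cast
    linear_combination h0
  rw [hq, isIntegral_algebraMap_iff (algebraMap ℚ K).injective,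
    IsIntegrallyClosed.isIntegral_iff] at hx
  obtain ⟨c, hc⟩ := hx
  have hdvd : c * (j + 2 : ℕ) = 1 := by
    rw [eq_div_iff (Nat.cast_ne_zero.2 (by omega)), eq_intCast] at hc
    exact_mod_cast hc
  have := Int.eq_one_or_neg_one_of_mul_eq_one' hdvd
  omega

theorem exists_aeval_unitFractionPoly_eq (d : ℕ) :
    ∃ (u : Finset ℝ) (c : ℝ), u.card = d ∧ ↑u ⊆ Set.Ioo (0 : ℝ) 1 ∧ 0 < c ∧
      ∀ x : ℝ, aeval x (unitFractionPoly d) = c * ∏ r ∈ u, (x - r) := by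
  have hinj : Function.Injective fun j : ℕ ↦ (1 : ℝ) / (j + 2) := fun i j h ↦ by
    simpa using h
  refine ⟨(Finset.range d).map ⟨_, hinj⟩, ∏ j ∈ Finset.range d, ((j : ℝ) + 2), by simp, ?_,
    Finset.prod_pos fun j _ ↦ by positivity, fun x ↦ ?_⟩
  · rw [Finset.coe_map]
    rintro _ ⟨j, -, rfl⟩
    change 1 / ((j : ℝ) + 2) ∈ _
    exact ⟨by positivity, (div_lt_one (by positivity)).2 (by linarith [j.cast_nonneg (α := ℝ)])⟩
  · rw [Finset.prod_map, aeval_unitFractionPoly, ← Finset.prod_mul_distrib]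
    refine Finset.prod_congr rfl fun j _ ↦ ?_
    change _ = (j + 2) * (x - 1 / (j + 2))
    field_simp

theorem finite_setOf_conj_norm_le (d : ℕ) (B : ℝ) :
    {z : ℂ | IsIntegral ℤ z ∧ (minpoly ℤ z).natDegree ≤ d ∧
      ∀ w : ℂ, aeval w (minpoly ℤ z) = 0 → ‖w‖ ≤ B}.Finite := by
  classical
  let M : ℤ := ⌈max B 1 ^ d * d.choose (d / 2)⌉
  refine (bUnion_roots_finite (algebraMap ℤ ℂ) d (Set.finite_Icc (-M) M)).subset ?_
  rintro z ⟨hz, hd, hconj⟩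
  have hmonic := (minpoly.monic hz).map (algebraMap ℤ ℂ)
  have hcoeff (i : ℕ) : (minpoly ℤ z).coeff i ∈ Set.Icc (-M) M := by
    have h := coeff_bdd_of_roots_le (B := B) (d := d) (RingHom.id ℂ) hmonic
      (IsAlgClosed.splits _) (by rwa [(minpoly.monic hz).natDegree_map]) (fun w hw ↦ by
        rw [Polynomial.map_id, mem_roots hmonic.ne_zero, IsRoot, eval_map_algebraMap] at hw
        exact hconj w hw) i
    rw [Polynomial.map_id, coeff_map, eq_intCast, Complex.norm_intCast] at h
    have := h.trans (Int.le_ceil _)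
    rw [Set.mem_Icc, ← abs_le]
    exact_mod_cast this
  refine Set.mem_iUnion₂.2 ⟨minpoly ℤ z, ⟨hd, hcoeff⟩, ?_⟩
  rw [Finset.mem_coe, Multiset.mem_toFinset, mem_roots hmonic.ne_zero, IsRoot,
    eval_map_algebraMap, minpoly.aeval]

/-- The factorisation pattern of the minimal polynomial of a Salem trace `β`: over `ℝ`, the
polynomial `R` is the product of `X - β` with `β > 2` and of distinct linear factors, at least one,
with roots in `(-2, 2)`. Irreducibility of `R` is not included. -/
def HasSalemRoots (R : ℤ[X]) (β : ℝ) : Prop :=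
  2 < β ∧ ∃ s : Finset ℝ, s.Nonempty ∧ ↑s ⊆ Set.Ioo (-2 : ℝ) 2 ∧
    R.map (algebraMap ℤ ℝ) = (X - C β) * ∏ r ∈ s, (X - C r)

namespace HasSalemRoots

variable {R : ℤ[X]} {β : ℝ}

theorem monic (h : HasSalemRoots R β) : R.Monic := by
  obtain ⟨-, s, -, -, hR⟩ := h
  refine monic_of_injective (algebraMap ℤ ℝ).injective_int ?_
  rw [hR]
  exact (monic_X_sub_C β).mul (monic_prod_X_sub_C id s)

theorem isIntegral (h : HasSalemRoots R β) : IsIntegral ℤ β := by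
  refine ⟨R, h.monic, ?_⟩
  obtain ⟨-, s, -, -, hR⟩ := h
  rw [← eval_map, hR]
  simp

theorem aeval_eq_zero (h : HasSalemRoots R β) : aeval β R = 0 := by
  obtain ⟨-, s, -, -, hR⟩ := h
  rw [← eval_map_algebraMap, hR]
  simp

theorem eq_or_mem_Ioo (h : HasSalemRoots R β) {z : ℂ} (hz : aeval z R = 0) :
    z = β ∨ ∃ x : ℝ, x ∈ Set.Ioo (-2) 2 ∧ (x : ℂ) = z := by
  obtain ⟨-, s, -, hs, hR⟩ := h
  rw [← aeval_map_algebraMap ℝ, hR, map_mul, map_prod, mul_eq_zero, Finset.prod_eq_zero_iff] at hz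
  refine hz.imp (fun hβ ↦ ?_) fun ⟨r, hr, hz⟩ ↦ ⟨r, hs hr, ?_⟩
  · simpa [sub_eq_zero] using hβ
  · simpa [sub_eq_zero, eq_comm] using hz

theorem exists_mem_Ioo (h : HasSalemRoots R β) :
    ∃ x : ℝ, x ∈ Set.Ioo (-2) 2 ∧ aeval x R = 0 := by
  obtain ⟨-, s, ⟨r, hr⟩, hs, hR⟩ := h
  refine ⟨r, hs hr, ?_⟩
  rw [← eval_map_algebraMap, hR, eval_mul, eval_prod,
    Finset.prod_eq_zero hr (by simp), mul_zero]

theorem aeval_ne_zero_of_mul_eq (h : HasSalemRoots R β) {P Q : ℤ[X]} (hPQ : R = P * Q)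
    (hP : aeval β P = 0) : aeval β Q ≠ 0 := by
  intro hQ
  obtain ⟨hβ, s, -, hs, hR⟩ := h
  obtain ⟨P', hP'⟩ := dvd_iff_isRoot.2 ((eval_map_algebraMap P β).trans hP)
  obtain ⟨Q', hQ'⟩ := dvd_iff_isRoot.2 ((eval_map_algebraMap Q β).trans hQ)
  rw [hPQ, Polynomial.map_mul, hP', hQ', mul_assoc] at hR
  have heval := congrArg (eval β) (mul_left_cancel₀ (X_sub_C_ne_zero β) hR)
  simp only [eval_mul, eval_sub, eval_X, eval_C, sub_self, zero_mul, mul_zero, eval_prod] at heval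
  exact (Finset.prod_pos fun r hr ↦ sub_pos.2 ((hs hr).2.trans hβ)).ne heval

theorem minpoly_eq (h : HasSalemRoots R β)
    (hR : ∀ z : ℂ, IsIntegral ℤ z → (minpoly ℤ z).natDegree ≤ R.natDegree →
      (∀ w : ℂ, aeval w (minpoly ℤ z) = 0 → ‖w‖ ≤ 2) → aeval z R ≠ 0) :
    minpoly ℤ β = R := by
  obtain ⟨Q, hQ⟩ := minpoly.isIntegrallyClosed_dvd h.isIntegral h.aeval_eq_zero
  have hQ_monic : Q.Monic :=
    (minpoly.monic h.isIntegral).of_mul_monic_left (hQ ▸ h.monic)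
  have hβQ := h.aeval_ne_zero_of_mul_eq hQ (minpoly.aeval ℤ β)
  suffices Q.natDegree = 0 by rw [hQ, hQ_monic.natDegree_eq_zero.1 this, mul_one]
  by_contra hdeg
  obtain ⟨z, hz⟩ := IsAlgClosed.exists_aeval_eq_zero_of_injective ℂ
    (algebraMap ℤ ℂ).injective_int Q
    (by rwa [Ne, degree_eq_natDegree hQ_monic.ne_zero, Nat.cast_eq_zero])
  have hz_int : IsIntegral ℤ z := ⟨Q, hQ_monic, hz⟩
  have hdvdQ : minpoly ℤ z ∣ Q := minpoly.isIntegrallyClosed_dvd hz_int hz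
  have hdvdR : minpoly ℤ z ∣ R := hdvdQ.trans (Dvd.intro_left _ hQ.symm)
  refine hR z hz_int (natDegree_le_of_dvd hdvdR h.monic.ne_zero) (fun w hw ↦ ?_)
    (aeval_eq_zero_of_dvd_aeval_eq_zero hdvdR (minpoly.aeval ℤ z))
  rcases h.eq_or_mem_Ioo (aeval_eq_zero_of_dvd_aeval_eq_zero hdvdR hw) with rfl | ⟨x, hx, rfl⟩
  · exact absurd ((aeval_algebraMap_eq_zero_iff ℂ β Q).1
      (aeval_eq_zero_of_dvd_aeval_eq_zero hdvdQ hw)) hβQ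
  · rw [Complex.norm_real, Real.norm_eq_abs, abs_le]
    exact ⟨hx.1.le, hx.2.le⟩

theorem isSalemTrace (h : HasSalemRoots (minpoly ℤ β) β) : IsSalemTrace β := by
  have hmap : minpoly ℚ β = (minpoly ℤ β).map (algebraMap ℤ ℚ) :=
    minpoly.isIntegrallyClosed_eq_field_fractions' ℚ h.isIntegral
  refine ⟨h.isIntegral, h.1, fun z hz hne ↦ ?_, ?_⟩
  · rw [hmap, aeval_map_algebraMap] at hz
    exact (h.eq_or_mem_Ioo hz).resolve_left hne
  · obtain ⟨x, hx, hroot⟩ := h.exists_mem_Ioo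
    refine ⟨x, ?_, ?_⟩
    · rw [hmap, aeval_map_algebraMap]
      exact (aeval_algebraMap_eq_zero_iff ℂ x _).2 hroot
    · exact_mod_cast (hx.2.trans h.1).ne

end HasSalemRoots

/-- The polynomial `E * G - 1` with `G = X ^ (d + 1) - a * unitFractionPoly d`; at its roots `E`
takes a unit value. -/
noncomputable def perturbedPoly (E : ℤ[X]) (d a : ℕ) : ℤ[X] :=
  E * (X ^ (d + 1) - C (a : ℤ) * unitFractionPoly d) - 1

theorem monic_perturbedPoly_and_natDegree {E : ℤ[X]} (hE : E.Monic) (d a : ℕ) :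
    (perturbedPoly E d a).Monic ∧ (perturbedPoly E d a).natDegree = E.natDegree + d + 1 := by
  have hH : (C (a : ℤ) * unitFractionPoly d).natDegree < (X ^ (d + 1) : ℤ[X]).natDegree := by
    rw [natDegree_X_pow]
    exact Nat.lt_succ_of_le
      ((natDegree_C_mul_le _ _).trans (natDegree_unitFractionPoly_le d))
  have hF : (X ^ (d + 1) - C (a : ℤ) * unitFractionPoly d).Monic :=
    (monic_X_pow _).sub_of_left (degree_lt_degree hH)
  have hEF := hE.natDegree_mul hF
  rw [natDegree_sub_eq_left_of_natDegree_lt hH, natDegree_X_pow, ← add_assoc] at hEF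
  have hlt : (1 : ℤ[X]).natDegree <
      (E * (X ^ (d + 1) - C (a : ℤ) * unitFractionPoly d)).natDegree := by
    rw [hEF, natDegree_one]
    exact Nat.succ_pos _
  exact ⟨(hE.mul hF).sub_of_left (degree_lt_degree hlt),
    (natDegree_sub_eq_left_of_natDegree_lt hlt).trans hEF⟩

theorem aeval_perturbedPoly {K : Type*} [CommRing K] (E : ℤ[X]) (d a : ℕ) (x : K) :
    aeval x (perturbedPoly E d a) =
      aeval x E * (x ^ (d + 1) - a * aeval x (unitFractionPoly d)) - 1 := by
  simp [perturbedPoly]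

theorem eq_of_aeval_perturbedPoly_eq_zero {K : Type*} [Field K] [CharZero K] {E : ℤ[X]}
    (hE : E.Monic) {d a b : ℕ} {x : K} (ha : aeval x (perturbedPoly E d a) = 0)
    (hb : aeval x (perturbedPoly E d b) = 0) : a = b := by
  have hx : IsIntegral ℤ x := ⟨_, (monic_perturbedPoly_and_natDegree hE d a).1, ha⟩
  have hH := aeval_unitFractionPoly_ne_zero d hx
  rw [aeval_perturbedPoly] at ha hb
  have hE0 : aeval x E ≠ 0 := left_ne_zero_of_mul_eq_one (sub_eq_zero.1 ha)
  have : ((a : K) - b) * (aeval x E * aeval x (unitFractionPoly d)) = 0 := by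
    linear_combination hb - ha
  exact_mod_cast sub_eq_zero.1 ((mul_eq_zero.1 this).resolve_right (mul_ne_zero hE0 hH))

section

variable {E : ℤ[X]} {s : Finset ℝ}

theorem exists_aeval_mul_unitFractionPoly_eq (hE : E.map (algebraMap ℤ ℝ) = ∏ r ∈ s, (X - C r))
    (hmin : IsLeast ↑s (-2 : ℝ)) (hmax : IsGreatest ↑s (2 : ℝ)) (d : ℕ) :
    ∃ (v : Finset ℝ) (c : ℝ), v.card = s.card + d ∧ IsLeast ↑v (-2 : ℝ) ∧ IsGreatest ↑v (2 : ℝ) ∧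
      0 < c ∧ ∀ x : ℝ, aeval x (E * unitFractionPoly d) = c * ∏ r ∈ v, (x - r) := by
  obtain ⟨u, c, hu, hu01, hc, hH⟩ := exists_aeval_unitFractionPoly_eq d
  have hdisj : Disjoint s u := Finset.disjoint_left.2 fun r hrs hru ↦
    aeval_unitFractionPoly_ne_zero d (x := r)
      ⟨E, monic_of_map_eq_prod hE,
        (aeval_of_map_eq_prod hE r).trans (Finset.prod_eq_zero hrs (sub_self r))⟩
      (by rw [hH, Finset.prod_eq_zero hru (sub_self r), mul_zero])
  refine ⟨s ∪ u, c, by rw [Finset.card_union_of_disjoint hdisj, hu], ?_, ?_, hc, fun x ↦ ?_⟩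
  · rw [Finset.coe_union]
    exact ⟨.inl hmin.1, fun r hr ↦ hr.elim (hmin.2 ·) fun hr ↦ by linarith [(hu01 hr).1]⟩
  · rw [Finset.coe_union]
    exact ⟨.inl hmax.1, fun r hr ↦ hr.elim (hmax.2 ·) fun hr ↦ by linarith [(hu01 hr).2]⟩
  · rw [map_mul, aeval_of_map_eq_prod hE, hH, Finset.prod_union hdisj]
    ring

theorem exists_hasSalemRoots_of_alternating {R : ℤ[X]} (hR : R.Monic) {x : ℕ → ℝ} {m : ℕ}
    (hm : Even m) (hm₀ : m ≠ 0) (hdeg : R.natDegree = m + 1) (hx_zero : x 0 = -2)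
    (hx_last : x m = 2) (hx : ∀ i < m, x i < x (i + 1))
    (hsign : ∀ i ≤ m, 0 < (-1) ^ i * -aeval (x i) R) : ∃ β, HasSalemRoots R β := by
  obtain ⟨s, hcard, hs, hroot⟩ :=
    exists_finset_zeros_of_alternating (f := fun y ↦ -aeval y R) (by fun_prop) hx hsign
  rw [hx_zero, hx_last] at hs
  obtain ⟨β, hβ⟩ := exists_eq_X_sub_C_mul_prod (f := R.map (algebraMap ℤ ℝ)) (s := s) (hR.map _)
    (fun r hr ↦ (eval_map_algebraMap R r).trans (neg_eq_zero.1 (hroot r hr)))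
    (by rw [hR.natDegree_map, hdeg, hcard])
  refine ⟨β, ?_, s, Finset.card_pos.1 (by omega), hs, hβ⟩
  have htwo : (2 - β) * ∏ r ∈ s, (2 - r) < 0 := by
    have := hsign m le_rfl
    rw [hm.neg_one_pow, one_mul, hx_last, neg_pos, ← eval_map_algebraMap, hβ, eval_mul,
      eval_prod] at this
    simpa only [eval_sub, eval_X, eval_C] using this
  have hprod : 0 < ∏ r ∈ s, (2 - r) := Finset.prod_pos fun r hr ↦ sub_pos.2 (hs hr).2
  exact sub_neg.1 (neg_of_mul_neg_left htwo hprod.le)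

theorem eventually_pos_mul_neg_aeval_perturbedPoly (E : ℤ[X]) (d : ℕ) {σ x : ℝ}
    (h : 0 < σ * aeval x (E * unitFractionPoly d)) :
    ∀ᶠ a in atTop, 0 < σ * -aeval x (perturbedPoly E d a) := by
  have htendsto : Tendsto (fun a : ℕ ↦ a * (σ * aeval x (E * unitFractionPoly d)) +
      σ * (1 - aeval x E * x ^ (d + 1))) atTop atTop :=
    tendsto_atTop_add_const_right _ _ (tendsto_natCast_atTop_atTop.atTop_mul_const h)
  filter_upwards [htendsto.eventually_gt_atTop 0] with a ha
  rw [map_mul] at ha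
  rw [aeval_perturbedPoly]
  linear_combination ha

theorem eventually_hasSalemRoots (hE : E.map (algebraMap ℤ ℝ) = ∏ r ∈ s, (X - C r))
    (hmin : IsLeast ↑s (-2 : ℝ)) (hmax : IsGreatest ↑s (2 : ℝ)) {d : ℕ} (hd : Even (s.card + d)) :
    ∀ᶠ a in atTop, ∃ β, HasSalemRoots (perturbedPoly E d a) β := by
  obtain ⟨v, c, hv, hv_min, hv_max, hc, hEH⟩ := exists_aeval_mul_unitFractionPoly_eq hE hmin hmax d
  have hv_card : 1 < v.card :=
    Finset.one_lt_card.2 ⟨-2, hv_min.1, 2, hv_max.1, by norm_num⟩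
  have hv_even : Even v.card := hv ▸ hd
  obtain ⟨x, hx_zero, hx_last, hx, hsign⟩ := exists_gap_points hv_card hv_min hv_max
  have hroot {r : ℝ} (hr : r ∈ s) (a : ℕ) : -aeval r (perturbedPoly E d a) = 1 := by
    rw [aeval_perturbedPoly, aeval_of_map_eq_prod hE, Finset.prod_eq_zero hr (sub_self r)]
    ring
  have hpos (i : ℕ) (hi : i ≤ v.card) :
      ∀ᶠ a in atTop, 0 < (-1) ^ i * -aeval (x i) (perturbedPoly E d a) := by
    rcases i.eq_zero_or_pos with rfl | hi₀
    · simp only [hx_zero, hroot hmin.1, pow_zero, one_mul, zero_lt_one, eventually_true]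
    rcases hi.eq_or_lt with rfl | hi
    · simp only [hx_last, hroot hmax.1, hv_even.neg_one_pow, one_mul, zero_lt_one,
        eventually_true]
    have hprod := mul_pos hc (hsign i hi₀ hi)
    rw [pow_add, hv_even.neg_one_pow, one_mul, mul_left_comm, ← hEH] at hprod
    exact eventually_pos_mul_neg_aeval_perturbedPoly E d hprod
  filter_upwards [(Set.finite_Iic v.card).eventually_all.2 hpos] with a ha
  have hE_deg := natDegree_of_map_eq_prod hE
  obtain ⟨hmonic, hdeg⟩ := monic_perturbedPoly_and_natDegree (monic_of_map_eq_prod hE) d a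
  exact exists_hasSalemRoots_of_alternating hmonic hv_even (by omega) (by omega)
    hx_zero hx_last hx ha

theorem finite_setOf_minpoly_ne_perturbedPoly (hE : E.Monic) (d : ℕ) :
    {a : ℕ | ∃ β, HasSalemRoots (perturbedPoly E d a) β ∧
      minpoly ℤ β ≠ perturbedPoly E d a}.Finite := by
  have hfin := (finite_setOf_conj_norm_le (E.natDegree + d + 1) 2).biUnion
    (t := fun z ↦ {a : ℕ | aeval z (perturbedPoly E d a) = 0}) fun z _ ↦
      Set.Subsingleton.finite fun a ha b hb ↦ eq_of_aeval_perturbedPoly_eq_zero hE ha hb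
  refine hfin.subset fun a ⟨β, hβ, hne⟩ ↦ ?_
  by_contra hno
  refine hne (hβ.minpoly_eq fun z hz hdeg hconj hroot ↦ hno ?_)
  rw [(monic_perturbedPoly_and_natDegree hE d a).2] at hdeg
  exact Set.mem_biUnion (x := z) ⟨hz, hdeg, hconj⟩ hroot

theorem infinite_setOf_isSalemTrace (hE : E.map (algebraMap ℤ ℝ) = ∏ r ∈ s, (X - C r))
    (hmin : IsLeast ↑s (-2 : ℝ)) (hmax : IsGreatest ↑s (2 : ℝ)) {t : ℕ} (ht : Odd t)
    (hst : s.card < t) :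
    {β : ℝ | IsSalemTrace β ∧ (minpoly ℚ β).natDegree = t ∧
      ∃ G : ℤ[X], aeval β (E * G) = 1}.Infinite := by
  obtain ⟨d, rfl⟩ := Nat.exists_eq_add_of_lt hst
  have hE_monic := monic_of_map_eq_prod hE
  have hd : Even (s.card + d) := by rwa [Nat.odd_add_one, Nat.not_odd_iff_even] at ht
  obtain ⟨A, hA⟩ := eventually_atTop.1 (eventually_hasSalemRoots hE hmin hmax hd)
  choose! β hβ using hA
  have hgood := (Set.Ici_infinite A).sdiff (finite_setOf_minpoly_ne_perturbedPoly hE_monic d)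
  refine Set.infinite_of_injOn_mapsTo (f := β) (fun a ha b hb hab ↦ ?_) (fun a ha ↦ ?_) hgood
  · exact eq_of_aeval_perturbedPoly_eq_zero hE_monic (hβ a ha.1).aeval_eq_zero
      (hab ▸ (hβ b hb.1).aeval_eq_zero)
  · have hroots := hβ a ha.1
    have hminpoly : minpoly ℤ (β a) = perturbedPoly E d a :=
      by_contra fun hne ↦ ha.2 ⟨β a, hroots, hne⟩
    refine ⟨(hminpoly ▸ hroots : HasSalemRoots (minpoly ℤ (β a)) (β a)).isSalemTrace, ?_,
      X ^ (d + 1) - C (a : ℤ) * unitFractionPoly d, ?_⟩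
    · rw [minpoly.isIntegrallyClosed_eq_field_fractions' ℚ hroots.isIntegral,
        (minpoly.monic hroots.isIntegral).natDegree_map, hminpoly,
        (monic_perturbedPoly_and_natDegree hE_monic d a).2, natDegree_of_map_eq_prod hE]
    · have hzero := hroots.aeval_eq_zero
      rwa [perturbedPoly, map_sub, map_one, sub_eq_zero] at hzero

end

theorem theorem1p3_general (n : ℕ) (hn : Even n) (hn₀ : 0 < n) (t : ℕ) (ht : Odd t)
    (hnt : n + 4 ≤ 2 * t) :
    {α : ℝ | IsSalemNumber α ∧ (minpoly ℚ α).natDegree = 2 * t ∧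
      IsAlgebraicUnit (α ^ n - 1)}.Infinite := by
  obtain ⟨k, rfl⟩ : ∃ k, n = 2 * (k + 1) := ⟨n / 2 - 1, by grind⟩
  obtain ⟨s, hcard, hmin, hmax, hE⟩ := exists_map_unityTracePoly_eq_prod k
  refine Set.Infinite.of_image (fun α ↦ α + α⁻¹)
    ((infinite_setOf_isSalemTrace hE hmin hmax ht (by omega)).mono ?_)
  rintro β ⟨hβ, hdeg, G, hG⟩
  obtain ⟨α, hα, rfl⟩ := exists_one_lt_add_inv_eq hβ.two_lt
  have hα₀ : α ≠ 0 := by positivity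
  exact ⟨α, ⟨hβ.isSalemNumber hα, by rw [hβ.natDegree_minpoly hα₀, hdeg],
    isAlgebraicUnit_pow_sub_one hα₀ hβ.isIntegral k hG⟩, rfl⟩

theorem theorem1p3 (n : ℕ) (hn : n ≡ 4 [MOD 8]) (hn5 : ¬ 5 ∣ n)
    (t : ℕ) (ht : Odd t) (hnt : ((n : ℝ) + 6) / 2 ≤ (t : ℝ)) :
    {α : ℝ | IsSalemNumber α ∧ (minpoly ℚ α).natDegree = 2 * t ∧
      IsAlgebraicUnit (α ^ n - 1)}.Infinite := by
  have hn_mod : n % 8 = 4 := hn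
  have hnt' : n + 6 ≤ 2 * t := by
    have : (n : ℝ) + 6 ≤ 2 * t := by linarith
    exact_mod_cast this
  exact theorem1p3_general n (Nat.even_iff.2 (by omega)) (by omega) t ht (by omega)
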